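/- Let $p$ be a prime and let $a,b\in\mathbb Z$. Consider lattice paths starting at $(0,0)$ with steps UP $=(1,1)$, LEVEL $=(1,0)$, DOWN $=(1,-1)$, where each UP or DOWN step has weight $a$, each LEVEL step has weight $b$, and the weight of a path is the product of the weights of its steps. Let $T^{a,b}_n$ (the generalized central trinomial coefficient) be the sum of the weights of all such paths from $(0,0)$ to $(n,0)$, and let $M^{a,b}_n$ (the generalized Motzkin number) be the sum of the weights of those among them that never go below the $x$-axis. (For $a,b\ge 0$ these are the numbers of such paths in which UP and DOWN steps carry one of $a$ colours and LEVEL steps one of $b$ colours.) The density of a residue $x\in\mathbb F_p$ in $M^{a,b}_n \bmod p$ is $\lim_{N\to\infty}\frac1N\left|\{n<N : M^{a,b}_n\equiv x \pmod p\}\right|$. All congruences below are modulo $p$. 1. If $T^{a,b}_n\equiv 0$ for some $0\le n<p$, then the density of $0$ in $M^{a,b}_n\bmod p$ exists and is $1$. 2. Suppose that $p>2$ and $T^{a,b}_n\not\equiv 0$ for all $0\le n<p$. Then the density $D_0$ of $0$ in $M^{a,b}_n\bmod p$ exists, and if $p\nmid a$, then $$D_0=\frac{\left|\{0\le n<p-2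 : M^{a,b}_n\equiv 0\}\right|}{p}+\frac{2\left|\{0\le m<p-1 : b\,T^{a,b}_m\equiv T^{a,b}_{p-1}T^{a,b}_{m+1}\}\right|}{(p-1)(p+1)}+\frac{2\left|\{0\le m<p-1 : b\,T^{a,b}_m\equiv T^{a,b}_{m+1}\}\right|}{(p-1)p(p+1)}.$$ If moreover the residues of $T^{a,b}_0,\dots,T^{a,b}_{p-1}$ generate the multiplicative group $\mathbb F_p^\times$, then every $k\in\mathbb F_p^\times$ has a density in $M^{a,b}_n\bmod p$, and it is equal to $\frac{1-D_0}{p-1}$. -/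

import Mathlib

/-- The weight of a step: `1`, `0`, `-1` stand for the steps UP, LEVEL, DOWN. There are `a` colours
for UP and for DOWN and `b` colours for LEVEL. -/
def stepWeight (a b : ℤ) (s : SignType) : ℤ := if s = 0 then b else a

/-- The weight of a lattice path with `n` steps: the product of its step weights. For `a, b ≥ 0`
this is the number of colourings of the path. -/
def pathWeight (a b : ℤ) {n : ℕ} (s : Fin n → SignType) : ℤ := ∏ i, stepWeight a b (s i)

/-- The height of the lattice path after its first `k` steps. -/
def pathHeight {n : ℕ} (s : Fin n → SignType) (k : ℕ) : ℤ :=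
  ∑ i : Fin n with i.val < k, (s i : ℤ)

/-- The generalized central trinomial coefficient: the weighted number of lattice paths from
`(0, 0)` to `(n, 0)`. -/
def centralTrinomial (a b : ℤ) (n : ℕ) : ℤ :=
  ∑ s : Fin n → SignType with pathHeight s n = 0, pathWeight a b s

/-- The generalized Motzkin number: the weighted number of lattice paths from `(0, 0)` to `(n, 0)`
that never go below the x-axis. -/
def motzkin (a b : ℤ) (n : ℕ) : ℤ :=
  ∑ s : Fin n → SignType with pathHeight s n = 0 ∧ ∀ k ≤ n, 0 ≤ pathHeight s k, pathWeight a b s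

/-- The set `S` of natural numbers has an asymptotic density, and it is equal to `d`. -/
def HasAsymptoticDensity (S : Set ℕ) (d : ℝ) : Prop :=
  Filter.Tendsto (fun N : ℕ => ((S ∩ {n | n < N}).ncard : ℝ) / (N : ℝ)) Filter.atTop (nhds d)

/-- The value `x` has density `d` in the sequence of generalized Motzkin numbers modulo `p`. -/
def MotzkinDensity (p : ℕ) (a b : ℤ) (x : ZMod p) (d : ℝ) : Prop :=
  HasAsymptoticDensity {n | (motzkin a b n : ZMod p) = x} d

/-- The explicit formula for the density of `0`. -/
noncomputable def zeroDensityFormula (p : ℕ) (a b : ℤ) : ℝ :=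
  ({n : ℕ | n < p - 2 ∧ (motzkin a b n : ZMod p) = 0}.ncard : ℝ) / p
  + 2 * ({m : ℕ | m < p - 1 ∧ (b : ZMod p) * centralTrinomial a b m =
      centralTrinomial a b (p - 1) * centralTrinomial a b (m + 1)}.ncard : ℝ)
    / (((p : ℝ) - 1) * (p + 1))
  + 2 * ({m : ℕ | m < p - 1 ∧ (b : ZMod p) * centralTrinomial a b m =
      centralTrinomial a b (m + 1)}.ncard : ℝ)
    / (((p : ℝ) - 1) * p * (p + 1))

/-! Let P = a x + b + a x⁻¹. Then T_n = [x⁰] Pⁿ and, by reflection, M_n = [x⁰] Pⁿ - [x²] Pⁿ. Modulo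
p, P(x)^p = P(x^p), which gives the Lucas congruence T_{pn+r} = T_n T_r for r < p (`walk_lucas`).
Since 2a² M_n is a combination of T_n, T_{n+1}, T_{n+2}, it follows for 2a² ≠ 0 that M_{pn+r} = M_r
T_n when r < p - 2, while the digits p - 2 and p - 1 give linear forms in T_n and T_{n+1}.

Densities are read off from means of Dirichlet characters: the principal one detects zeros, and the
others measure equidistribution. Digit recurrences determine these means
(`HasMean.of_digit_recurrence`). If no T_r vanishes, ε = T_{p-1} satisfies ε² = 1, and the last
digit p - 1 exchanges the forms xεT_n + yT_{n+1} and xT_n + yT_{n+1}; every other digit makes them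
multiples of T_n. Solving this 2 × 2 system (`HasMean.of_swap`) produces the denominators p - 1 and
p + 1. Every character mean of M is thus a multiple of that of T, and the latter vanishes for
nontrivial characters when the T_r generate.

If some T_m vanishes, T_n is almost always 0; a similar digit argument makes [x¹] Pⁿ almost always 0
too, and both together force M_{pn+r} = 0. -/

/-! ### Weighted walks on `ℤ` -/

/-- The weighted number of lattice paths with `n` steps from height `0` to height `j`. -/
def walk {R : Type*} [CommRing R] (a b : R) : ℕ → ℤ → R
  | 0, j => if j = 0 then 1 else 0
  | n + 1, j => a * walk a b n (j - 1) + b * walk a b n j + a * walk a b n (j + 1)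

section Walk

variable {R : Type*} [CommRing R] (a b : R)

theorem walk_zero (j : ℤ) : walk a b 0 j = if j = 0 then 1 else 0 := rfl

theorem walk_succ (n : ℕ) (j : ℤ) :
    walk a b (n + 1) j = a * walk a b n (j - 1) + b * walk a b n j + a * walk a b n (j + 1) := rfl

theorem walk_neg (n : ℕ) (j : ℤ) : walk a b n (-j) = walk a b n j := by
  induction n generalizing j with
  | zero => simp [walk_zero]
  | succ n ih =>
    rw [walk_succ, walk_succ, show -j - 1 = -(j + 1) by ring, show -j + 1 = -(j - 1) by ring,
      ih, ih, ih]
    ring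

theorem walk_eq_zero_of_lt (n : ℕ) (j : ℤ) (h : (n : ℤ) < |j|) : walk a b n j = 0 := by
  induction n generalizing j with
  | zero =>
    rw [walk_zero, if_neg]
    rintro rfl
    simp at h
  | succ n ih =>
    push_cast at h
    rw [walk_succ, ih _ (by grind), ih _ (by grind), ih _ (by grind)]
    ring

theorem walk_self (n : ℕ) : walk a b n n = a ^ n := by
  induction n with
  | zero => simp [walk_zero]
  | succ n ih =>
    rw [walk_succ, walk_eq_zero_of_lt a b n ((n + 1 : ℕ) : ℤ) (by grind),
      walk_eq_zero_of_lt a b n ((n + 1 : ℕ) + 1 : ℤ) (by grind)]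
    push_cast
    rw [add_sub_cancel_right, ih]
    ring

theorem map_walk {S : Type*} [CommRing S] (f : R →+* S) (n : ℕ) (j : ℤ) :
    f (walk a b n j) = walk (f a) (f b) n j := by
  induction n generalizing j with
  | zero => simp [walk_zero, apply_ite f]
  | succ n ih => simp [walk_succ, ih]

theorem walk_zero_weight (n : ℕ) (j : ℤ) (hj : j ≠ 0) : walk 0 b n j = 0 := by
  induction n with
  | zero => simp [walk_zero, hj]
  | succ n ih => simp [walk_succ, ih]

/-- Comparison of coefficients in `x · d/dx (P ^ (n + 1)) = (n + 1) · P ^ n · x · dP/dx` for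
`P = a x + b + a x⁻¹`. -/
theorem intCast_mul_walk_succ (n : ℕ) (j : ℤ) :
    (j : R) * walk a b (n + 1) j =
      (n + 1) * a * (walk a b n (j - 1) - walk a b n (j + 1)) := by
  induction n generalizing j with
  | zero =>
    simp only [walk_succ, walk_zero]
    rcases eq_or_ne j 0 with rfl | h0
    · simp
    rcases eq_or_ne j 1 with rfl | h1
    · simp
    rcases eq_or_ne j (-1) with rfl | h2
    · simp
    · rw [if_neg (by lia), if_neg (by lia), if_neg (by lia)]
      simp
  | succ n ih =>
    have h1 := ih (j - 1)
    have h2 := ih j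
    have h3 := ih (j + 1)
    have e1 := walk_succ a b n (j - 1)
    have e3 := walk_succ a b n (j + 1)
    rw [walk_succ a b (n + 1) j]
    simp only [sub_add_cancel, add_sub_cancel_right] at *
    push_cast at *
    linear_combination a * h1 + b * h2 + a * h3 - (n + 1) * a * e1 + (n + 1) * a * e3

theorem walk_succ_zero (n : ℕ) :
    walk a b (n + 1) 0 = b * walk a b n 0 + 2 * a * walk a b n 1 := by
  have h := walk_neg a b n 1
  rw [walk_succ, zero_sub, h, zero_add]
  ring

theorem walk_succ_one (n : ℕ) :
    walk a b (n + 1) 1 = a * walk a b n 0 + b * walk a b n 1 + a * walk a b n 2 := by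
  rw [walk_succ]
  norm_num

/-- Eliminating the coefficient at height 1 expresses Motzkin numbers through central trinomial
coefficients, to which the Lucas congruence applies. -/
theorem two_mul_sq_mul_walk_sub (n : ℕ) :
    2 * a ^ 2 * (walk a b n 0 - walk a b n 2) =
      (4 * a ^ 2 - b ^ 2) * walk a b n 0 + 2 * b * walk a b (n + 1) 0 - walk a b (n + 2) 0 := by
  have h1 := walk_succ_zero a b n
  have h2 := walk_succ_zero a b (n + 1)
  have h3 := walk_succ_one a b n
  linear_combination h2 + 2 * a * h3 - b * h1

/-- The three-term recurrence of the central trinomial coefficients. -/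
theorem walk_recurrence (n : ℕ) :
    (n + 2) * walk a b (n + 2) 0 =
      (2 * n + 3) * b * walk a b (n + 1) 0 - (n + 1) * (b ^ 2 - 4 * a ^ 2) * walk a b n 0 := by
  have h1 := walk_succ_zero a b n
  have h2 := walk_succ_zero a b (n + 1)
  have h3 := walk_succ_one a b n
  have h4 := intCast_mul_walk_succ a b n 1
  norm_num at h4
  linear_combination (n + 2) * h2 + 2 * a * h4 + (n + 1) * 2 * a * h3 - (n + 1) * b * h1

end Walk

/-! ### Lattice paths and walks -/

theorem pathHeight_snoc_of_le {n : ℕ} (s : Fin n → SignType) (x : SignType) {k : ℕ} (hk : k ≤ n) :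
    pathHeight (Fin.snoc s x : Fin (n + 1) → SignType) k = pathHeight s k := by
  simp only [pathHeight, Finset.sum_filter, Fin.sum_univ_castSucc, Fin.snoc_castSucc,
    Fin.val_castSucc, Fin.val_last, if_neg (not_lt.2 hk), add_zero]

theorem pathHeight_snoc_last {n : ℕ} (s : Fin n → SignType) (x : SignType) :
    pathHeight (Fin.snoc s x : Fin (n + 1) → SignType) (n + 1) = pathHeight s n + x := by
  simp [pathHeight, Finset.sum_filter, Fin.sum_univ_castSucc]

theorem pathWeight_snoc (a b : ℤ) {n : ℕ} (s : Fin n → SignType) (x : SignType) :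
    pathWeight a b (Fin.snoc s x : Fin (n + 1) → SignType) =
      pathWeight a b s * stepWeight a b x := by
  simp [pathWeight, Fin.prod_univ_castSucc]

theorem sum_signType {M : Type*} [AddCommMonoid M] (f : SignType → M) :
    ∑ x, f x = f 1 + f 0 + f (-1) := by
  have : (Finset.univ : Finset SignType) = {1, 0, -1} := by decide
  rw [this]
  simp [add_assoc]

theorem sum_paths_succ {M : Type*} [AddCommMonoid M] {n : ℕ}
    (f : (Fin (n + 1) → SignType) → M) :
    ∑ s, f s = ∑ s : Fin n → SignType,
      (f (Fin.snoc s 1) + f (Fin.snoc s 0) + f (Fin.snoc s (-1))) := by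
  rw [← (Fin.snocEquiv fun _ : Fin (n + 1) => SignType).sum_comp, Fintype.sum_prod_type,
    Finset.sum_comm]
  simp only [sum_signType]
  rfl

theorem sum_paths_eq_walk (a b : ℤ) (n : ℕ) (j : ℤ) :
    ∑ s : Fin n → SignType with pathHeight s n = j, pathWeight a b s = walk a b n j := by
  induction n generalizing j with
  | zero =>
    simp only [Finset.sum_filter, pathHeight, pathWeight, walk_zero]
    simp [eq_comm]
  | succ n ih =>
    rw [walk_succ, ← ih, ← ih, ← ih]
    simp only [Finset.sum_filter, sum_paths_succ, pathHeight_snoc_last, pathWeight_snoc,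
      Finset.mul_sum, ← Finset.sum_add_distrib]
    refine Finset.sum_congr rfl fun s _ => ?_
    simp only [stepWeight, SignType.coe_one, SignType.coe_zero, SignType.coe_neg_one, add_zero,
      eq_sub_iff_add_eq, ← sub_eq_add_neg, sub_eq_iff_eq_add]
    norm_num
    simp only [mul_comm]

theorem centralTrinomial_eq_walk (a b : ℤ) (n : ℕ) : centralTrinomial a b n = walk a b n 0 :=
  sum_paths_eq_walk a b n 0

theorem nonneg_snoc_iff {n : ℕ} (s : Fin n → SignType) (x : SignType) :
    (∀ k ≤ n + 1, 0 ≤ pathHeight (Fin.snoc s x : Fin (n + 1) → SignType) k) ↔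
      (∀ k ≤ n, 0 ≤ pathHeight s k) ∧ 0 ≤ pathHeight s n + x := by
  rw [← pathHeight_snoc_last]
  refine ⟨fun h => ⟨fun k hk => ?_, h _ le_rfl⟩, fun h k hk => ?_⟩
  · rw [← pathHeight_snoc_of_le s x hk]
    exact h k (by lia)
  · rcases Nat.le_succ_iff.1 hk with hk | rfl
    · rw [pathHeight_snoc_of_le s x hk]
      exact h.1 k hk
    · exact h.2

/-- The reflection principle. -/
theorem sum_nonneg_paths_eq_walk_sub (a b : ℤ) (n : ℕ) (j : ℤ) (hj : -1 ≤ j) :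
    ∑ s : Fin n → SignType with pathHeight s n = j ∧ ∀ k ≤ n, 0 ≤ pathHeight s k,
      pathWeight a b s = walk a b n j - walk a b n (j + 2) := by
  -- Height -1 is admitted so that the induction at j = 0 may refer to j - 1; there both sides are
  -- 0, the right one by the symmetry j ↦ -j.
  have neg_one (n : ℕ) : ∑ s : Fin n → SignType with
      pathHeight s n = -1 ∧ ∀ k ≤ n, 0 ≤ pathHeight s k, pathWeight a b s =
        walk a b n (-1) - walk a b n (-1 + 2) := by
    rw [Finset.sum_filter, Finset.sum_eq_zero]
    · norm_num [walk_neg]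
    · intro s _
      rw [if_neg]
      rintro ⟨h1, h2⟩
      have := h2 n le_rfl
      lia
  induction n generalizing j with
  | zero =>
    rcases hj.eq_or_lt with rfl | hj
    · exact neg_one 0
    have : j + 2 ≠ 0 := by lia
    simp only [Finset.sum_filter, pathHeight, pathWeight, walk_zero]
    simp [this, eq_comm]
  | succ n ih =>
    rcases hj.eq_or_lt with rfl | hj
    · exact neg_one (n + 1)
    have e : walk a b (n + 1) j - walk a b (n + 1) (j + 2) =
        a * (walk a b n (j - 1) - walk a b n (j - 1 + 2)) +
        b * (walk a b n j - walk a b n (j + 2)) +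
        a * (walk a b n (j + 1) - walk a b n (j + 1 + 2)) := by
      rw [walk_succ, walk_succ]
      ring_nf
    rw [e, ← ih _ (by lia), ← ih _ (by lia), ← ih _ (by lia)]
    simp only [Finset.sum_filter, sum_paths_succ, pathHeight_snoc_last, pathWeight_snoc,
      nonneg_snoc_iff, Finset.mul_sum, ← Finset.sum_add_distrib]
    refine Finset.sum_congr rfl fun s _ => ?_
    by_cases hs : ∀ k ≤ n, 0 ≤ pathHeight s k
    · have h0 := hs n le_rfl
      have hs' : (∀ k ≤ n, 0 ≤ pathHeight s k) = True := eq_true hs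
      simp only [hs', stepWeight, SignType.coe_one, SignType.coe_zero, SignType.coe_neg_one,
        one_ne_zero, if_true, if_false, true_and, and_true, (by decide : (-1 : SignType) ≠ 0)]
      clear ih e hs hs' neg_one
      grind
    · simp [hs]

theorem motzkin_eq_walk_sub (a b : ℤ) (n : ℕ) :
    motzkin a b n = walk a b n 0 - walk a b n 2 :=
  sum_nonneg_paths_eq_walk_sub a b n 0 (by lia)

/-! ### Walks modulo a prime -/

open AddMonoidAlgebra in
theorem walk_eq_coeff {R : Type*} [CommRing R] (a b : R) (n : ℕ) (j : ℤ) :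
    walk a b n j = ((single 1 a + single 0 b + single (-1) a : AddMonoidAlgebra R ℤ) ^ n).coeff j
      := by
  induction n generalizing j with
  | zero =>
    rw [pow_zero, one_def, coeff_single, Finsupp.single_apply, walk_zero]
    simp only [eq_comm]
  | succ n ih =>
    rw [pow_succ', add_mul, add_mul, coeff_add, coeff_add, Finsupp.add_apply, Finsupp.add_apply,
      coeff_single_mul_apply, coeff_single_mul_apply, coeff_single_mul_apply, ← ih, ← ih, ← ih,
      walk_succ]
    ring_nf

section ModPrime

variable {p : ℕ} [Fact p.Prime] (a b : ZMod p)

open AddMonoidAlgebra in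
-- Frobenius: P^p = a x^p + b + a x^(-p), because a^p = a and b^p = b in `ZMod p`.
theorem walk_prime_add (m : ℕ) (j : ℤ) :
    walk a b (p + m) j = a * walk a b m (j - p) + b * walk a b m j + a * walk a b m (j + p) := by
  have : CharP (AddMonoidAlgebra (ZMod p) ℤ) p :=
    charP_of_injective_algebraMap (algebraMap (ZMod p) (AddMonoidAlgebra (ZMod p) ℤ)).injective p
  simp only [walk_eq_coeff]
  rw [pow_add, add_pow_char, add_pow_char, single_pow, single_pow, single_pow, ZMod.pow_card,
    ZMod.pow_card, add_mul, add_mul, coeff_add, coeff_add, Finsupp.add_apply, Finsupp.add_apply,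
      coeff_single_mul_apply, coeff_single_mul_apply, coeff_single_mul_apply]
  simp [add_comm, sub_eq_add_neg]

/-- The Lucas-type congruence for the coefficients of a power of `a x + b + a x⁻¹`. -/
theorem walk_mul_add (n : ℕ) {r : ℕ} (hr : r < p) (i : ℤ) {s : ℕ} (hs : s < p) :
    walk a b (p * n + r) (p * i + s) =
      walk a b n i * walk a b r s + walk a b n (i + 1) * walk a b r (s - p) := by
  induction n generalizing i with
  | zero =>
    simp only [mul_zero, zero_add, walk_zero]
    rcases eq_or_ne i 0 with rfl | h0
    · simp
    rcases eq_or_ne i (-1) with rfl | h1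
    · simp [sub_eq_neg_add]
    -- P^r is supported on heights of absolute value at most r < p, so only i = 0 and i = -1
    -- contribute.
    rw [walk_eq_zero_of_lt, if_neg h0, if_neg (by lia)]
    · ring
    · have : i ≤ -2 ∨ 1 ≤ i := by lia
      rcases this with h | h
      · have : (p : ℤ) * i ≤ p * (-2) := by gcongr
        grind
      · have : (p : ℤ) * 1 ≤ p * i := by gcongr
        grind
  | succ n ih =>
    rw [show p * (n + 1) + r = p + (p * n + r) by ring, walk_prime_add,
      show (p : ℤ) * i + s - p = p * (i - 1) + s by ring,
      show (p : ℤ) * i + s + p = p * (i + 1) + s by ring, ih, ih, ih, walk_succ, walk_succ]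
    ring_nf

theorem walk_lucas (n : ℕ) {r : ℕ} (hr : r < p) :
    walk a b (p * n + r) 0 = walk a b n 0 * walk a b r 0 := by
  have h := walk_mul_add a b n hr 0 (s := 0) (by lia)
  simp only [mul_zero, Nat.cast_zero, add_zero, zero_sub] at h
  rw [h, walk_eq_zero_of_lt a b r (-p) (by grind), mul_zero, add_zero]

theorem walk_lucas_succ (n : ℕ) : walk a b (p * n + p) 0 = walk a b (n + 1) 0 := by
  have h := walk_lucas a b (n + 1) (r := 0) (Nat.Prime.pos Fact.out)
  simpa [mul_add, walk_zero] using h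

theorem walk_lucas_succ_succ (n : ℕ) :
    walk a b (p * n + p + 1) 0 = b * walk a b (n + 1) 0 := by
  have h := walk_lucas a b (n + 1) (r := 1) (Nat.Prime.one_lt Fact.out)
  simpa [mul_add, walk_succ, walk_zero, mul_comm] using h

/-- The symmetry of the central trinomial coefficients modulo `p`. -/
theorem walk_symm {m : ℕ} (hm : m < p) :
    (b ^ 2 - 4 * a ^ 2) ^ m * walk a b (p - 1 - m) 0 = walk a b (p - 1) 0 * walk a b m 0 := by
  induction m using Nat.strong_induction_on with
  | _ m ih =>
  match m with
  | 0 => simp [walk_zero]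
  | 1 =>
    -- Here the leading coefficient of the recurrence is p = 0. In general, m ↦ p - 1 - m turns the
    -- recurrence modulo p into itself, up to powers of b² - 4a².
    have h := walk_recurrence a b (p - 2)
    have e := walk_lucas_succ a b 0
    simp only [mul_zero, zero_add] at e
    have e2 : ((p - 2 : ℕ) : ZMod p) = -2 := by
      rw [Nat.cast_sub (by lia)]; simp
    rw [show p - 2 + 2 = p by lia, show p - 2 + 1 = p - 1 by lia, e, e2] at h
    rw [show p - 1 - 1 = p - 2 by lia]
    simp [walk_succ, walk_zero] at h ⊢
    linear_combination -h
  | m + 2 =>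
    have h1 := ih (m + 1) (by lia) (by lia)
    have h0 := ih m (by lia) (by lia)
    have h := walk_recurrence a b (p - 1 - (m + 2))
    have h' := walk_recurrence a b m
    have e2 : ((p - 1 - (m + 2) : ℕ) : ZMod p) = -(m + 3) := by
      rw [Nat.sub_sub, Nat.cast_sub (by lia)]; push_cast; simp; ring
    rw [show p - 1 - (m + 2) + 2 = p - 1 - m by lia,
      show p - 1 - (m + 2) + 1 = p - 1 - (m + 1) by lia, e2] at h
    have hne : ((m : ZMod p) + 2) ≠ 0 := by
      have : ((m + 2 : ℕ) : ZMod p) ≠ 0 := by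
        rw [Ne, ZMod.natCast_eq_zero_iff]
        exact Nat.not_dvd_of_pos_of_lt (by lia) hm
      simpa using this
    apply mul_left_cancel₀ hne
    linear_combination (-(b ^ 2 - 4 * a ^ 2) ^ (m + 1)) * h + (2 * m + 3) * b * h1
      - (m + 1) * (b ^ 2 - 4 * a ^ 2) * h0 - walk a b (p - 1) 0 * h'

end ModPrime

/-! ### Mean values of sequences -/

open Filter Topology Asymptotics in
/-- The averages of the first `N` terms of `f` converge to `d`. -/
def HasMean (f : ℕ → ℂ) (d : ℂ) : Prop :=
  Tendsto (fun N : ℕ => (∑ n ∈ Finset.range N, f n) / (N : ℂ)) atTop (𝓝 d)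

section Mean

open Filter Topology Asymptotics Finset

theorem HasMean.add {f g : ℕ → ℂ} {d e : ℂ} (hf : HasMean f d) (hg : HasMean g e) :
    HasMean (fun n => f n + g n) (d + e) := by
  refine (Tendsto.add hf hg).congr fun N => ?_
  rw [sum_add_distrib, add_div]

theorem HasMean.const_mul {f : ℕ → ℂ} {d : ℂ} (hf : HasMean f d) (c : ℂ) :
    HasMean (fun n => c * f n) (c * d) := by
  refine (Tendsto.const_mul c hf).congr fun N => ?_
  rw [← mul_sum, mul_div_assoc]

theorem HasMean.sub {f g : ℕ → ℂ} {d e : ℂ} (hf : HasMean f d) (hg : HasMean g e) :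
    HasMean (fun n => f n - g n) (d - e) := by
  refine (Tendsto.sub hf hg).congr fun N => ?_
  rw [sum_sub_distrib, sub_div]

theorem HasMean.sum {ι : Type*} (s : Finset ι) {f : ι → ℕ → ℂ} {d : ι → ℂ}
    (hf : ∀ i ∈ s, HasMean (f i) (d i)) : HasMean (fun n => ∑ i ∈ s, f i n) (∑ i ∈ s, d i) := by
  refine (tendsto_finsetSum s hf).congr fun N => ?_
  rw [sum_comm, sum_div]

theorem hasMean_const (c : ℂ) : HasMean (fun _ => c) c := by
  refine tendsto_const_nhds.congr' ?_
  filter_upwards [eventually_ne_atTop 0] with N hN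
  have : (N : ℂ) ≠ 0 := by exact_mod_cast hN
  simp [this]

theorem hasMean_iff_isLittleO {f : ℕ → ℂ} {d : ℂ} :
    HasMean f d ↔
      (fun N : ℕ => ∑ n ∈ range N, (f n - d)) =o[atTop] (fun N : ℕ => (N : ℂ)) := by
  rw [isLittleO_iff_tendsto', HasMean, ← tendsto_sub_nhds_zero_iff]
  · refine tendsto_congr' ?_
    filter_upwards [eventually_ne_atTop 0] with N hN
    have : (N : ℂ) ≠ 0 := by exact_mod_cast hN
    rw [sum_sub_distrib]
    simp only [sum_const, card_range, nsmul_eq_mul]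
    field_simp
  · filter_upwards [eventually_ne_atTop 0] with N hN h
    exact absurd (by exact_mod_cast h) hN

theorem HasMean.zero_of_norm_le {f g : ℕ → ℂ} (hg : HasMean (fun n => (‖g n‖ : ℂ)) 0)
    (h : ∀ n, ‖f n‖ ≤ ‖g n‖) : HasMean f 0 := by
  refine squeeze_zero_norm (fun N => ?_) (tendsto_zero_iff_norm_tendsto_zero.1 hg)
  rw [norm_div, norm_div]
  gcongr
  rw [← Complex.ofReal_sum, Complex.norm_real, Real.norm_eq_abs]
  exact (norm_sum_le _ _).trans ((sum_le_sum fun n _ => h n).trans (le_abs_self _))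

theorem sum_range_mul_eq {M : Type*} [AddCommMonoid M] (p N : ℕ) (f : ℕ → M) :
    ∑ n ∈ range (p * N), f n = ∑ n ∈ range N, ∑ r ∈ range p, f (p * n + r) := by
  induction N with
  | zero => simp
  | succ N ih => rw [mul_add, mul_one, sum_range_add, ih, sum_range_succ]

/-- A bounded sequence that satisfies an affine recurrence with respect to the last base-`p` digit
has a mean, if the recurrence is contracting on average. -/
theorem HasMean.of_digit_recurrence {p : ℕ} (hp : 0 < p) {f : ℕ → ℂ} {B : ℝ}
    (hB : ∀ n, ‖f n‖ ≤ B) {c d : ℕ → ℂ} {h : ℕ → ℕ → ℂ}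
    (hf : ∀ n, ∀ r < p, f (p * n + r) = c r * f n + h r n)
    (hh : ∀ r < p, HasMean (h r) (d r)) (hc : ‖∑ r ∈ range p, c r‖ < p) :
    HasMean f ((∑ r ∈ range p, d r) / (p - ∑ r ∈ range p, c r)) := by
  set C := ∑ r ∈ range p, c r with hC
  set m := (∑ r ∈ range p, d r) / (p - C) with hm
  have hp' : (0 : ℝ) < p := by exact_mod_cast hp
  have hne : (p : ℂ) - C ≠ 0 := by
    intro h0
    rw [← sub_eq_zero.1 h0] at hc
    simp at hc
  have hm' : ∑ r ∈ range p, d r = (p - C) * m := by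
    rw [hm]
    field_simp
  rw [hasMean_iff_isLittleO]
  set G : ℕ → ℂ := fun N => ∑ n ∈ range N, (f n - m) with hG
  set H : ℕ → ℂ := fun N => ∑ r ∈ range p, ∑ n ∈ range N, (h r n - d r) with hH
  have hHo : H =o[atTop] (fun N : ℕ => (N : ℂ)) := by
    convert! IsLittleO.sum fun r hr => hasMean_iff_isLittleO.1 (hh r (mem_range.1 hr)) using 1
    ext N
    simp [hH]
  -- Grouping by the last digit makes the centred partial sums self-similar, with an error o(N).
  have hGH : ∀ N, G (p * N) = C * G N + H N := by
    intro N
    simp only [hG, hH]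
    rw [sum_range_mul_eq, sum_comm (s := range p), mul_sum, ← sum_add_distrib]
    refine sum_congr rfl fun n _ => ?_
    rw [sum_congr rfl fun r hr => by rw [hf n r (mem_range.1 hr)]]
    simp only [sum_sub_distrib, sum_add_distrib, ← sum_mul, ← hC, hm', sum_const, card_range,
      nsmul_eq_mul]
    ring
  set A : ℝ := B + ‖m‖ with hA
  have hg : ∀ n, ‖f n - m‖ ≤ A := fun n => (norm_sub_le _ _).trans (by simpa [hA] using hB n)
  have hA0 : 0 ≤ A := (norm_nonneg _).trans (hg 0)
  have hGA : ∀ N, ‖G N‖ ≤ A * N := by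
    intro N
    refine (norm_sum_le _ _).trans ((sum_le_sum fun n _ => hg n).trans ?_)
    simp [mul_comm]
  have hGr : ∀ N, ‖G N‖ ≤ ‖G (p * (N / p))‖ + A * p := by
    intro N
    have e : G N = G (p * (N / p)) + ∑ n ∈ range (N % p), (f (p * (N / p) + n) - m) := by
      simp only [hG]
      rw [← sum_range_add (fun n => f n - m), Nat.div_add_mod]
    rw [e]
    refine (norm_add_le _ _).trans (add_le_add le_rfl ?_)
    refine (norm_sum_le _ _).trans ((sum_le_sum fun n _ => hg _).trans ?_)
    have : ((N % p : ℕ) : ℝ) ≤ p := by exact_mod_cast (Nat.mod_lt N hp).le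
    simp only [sum_const, card_range, nsmul_eq_mul]
    nlinarith
  set θ : ℝ := ‖C‖ / p with hθ
  have hθ0 : 0 ≤ θ := by positivity
  have hθ1 : θ < 1 := (div_lt_one hp').2 hc
  -- Q collects the eventual linear bounds for G. It is stable under q ↦ θq + δ with θ < 1, so its
  -- infimum cannot be positive.
  set Q : Set ℝ := {q | 0 ≤ q ∧ ∀ᶠ N : ℕ in atTop, ‖G N‖ ≤ q * N} with hQ
  have hQA : A ∈ Q := ⟨hA0, Eventually.of_forall hGA⟩
  have hQb : BddBelow Q := ⟨0, fun q hq => hq.1⟩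
  have step : ∀ q ∈ Q, ∀ δ > 0, θ * q + δ ∈ Q := by
    rintro q ⟨hq0, hq⟩ δ hδ
    refine ⟨by positivity, ?_⟩
    have htend : Tendsto (fun N : ℕ => N / p) atTop atTop := Nat.tendsto_div_const_atTop hp.ne'
    have h1 := htend.eventually hq
    have h2 := htend.eventually (isLittleO_iff.1 hHo (half_pos hδ))
    have h3 : ∀ᶠ N : ℕ in atTop, A * p / (δ / 2) ≤ N :=
      tendsto_natCast_atTop_atTop.eventually_ge_atTop _
    filter_upwards [h1, h2, h3] with N h1 h2 h3
    rw [div_le_iff₀ (half_pos hδ)] at h3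
    have hdiv : ((N / p : ℕ) : ℝ) ≤ N / p := Nat.cast_div_le
    have hdiv' : ((N / p : ℕ) : ℝ) ≤ N := by exact_mod_cast Nat.div_le_self N p
    rw [Complex.norm_natCast] at h2
    calc ‖G N‖ ≤ ‖G (p * (N / p))‖ + A * p := hGr N
      _ ≤ ‖C‖ * ‖G (N / p)‖ + ‖H (N / p)‖ + A * p := by
        rw [hGH, ← norm_mul]
        gcongr
        exact norm_add_le _ _
      _ ≤ ‖C‖ * (q * (N / p)) + δ / 2 * N + N * (δ / 2) := by
        gcongr
        · exact h1.trans (by gcongr)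
        · exact h2.trans (by gcongr)
      _ = (θ * q + δ) * N := by
        rw [hθ]
        ring
  have hL : sInf Q ≤ 0 := by
    by_contra! hpos
    have hη : 0 < (1 - θ) * sInf Q / 4 := by
      have := mul_pos (sub_pos.2 hθ1) hpos
      positivity
    obtain ⟨q, hq, hlt⟩ := exists_lt_of_csInf_lt ⟨A, hQA⟩ (lt_add_of_pos_right (sInf Q) hη)
    have h1 := csInf_le hQb (step q hq _ hη)
    nlinarith
  rw [isLittleO_iff]
  intro ε hε
  obtain ⟨q, hq, hlt⟩ := exists_lt_of_csInf_lt ⟨A, hQA⟩ (hL.trans_lt hε)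
  filter_upwards [hq.2] with N hN
  rw [Complex.norm_natCast]
  exact hN.trans (by gcongr)

theorem HasMean.of_digits {p : ℕ} (hp : 0 < p) {f : ℕ → ℂ} {B : ℝ} (hB : ∀ n, ‖f n‖ ≤ B)
    {d : ℕ → ℂ} (hd : ∀ r < p, HasMean (fun n => f (p * n + r)) (d r)) :
    HasMean f ((∑ r ∈ range p, d r) / p) := by
  have := HasMean.of_digit_recurrence hp hB (c := fun _ => 0) (d := d)
    (h := fun r n => f (p * n + r)) (by simp) hd (by simpa using hp)
  simpa using this

/-- Two sequences that are exchanged by the digit `p - 1` and are multiples of a sequence with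
mean `t` at the other digits. -/
theorem HasMean.of_swap {p : ℕ} (hp : 1 < p) {f g u : ℕ → ℂ} {B : ℝ} (hfB : ∀ n, ‖f n‖ ≤ B)
    (hgB : ∀ n, ‖g n‖ ≤ B) {t : ℂ} (hu : HasMean u t) {α β : ℕ → ℂ}
    (hf : ∀ n, ∀ r < p - 1, f (p * n + r) = α r * u n)
    (hg : ∀ n, ∀ r < p - 1, g (p * n + r) = β r * u n)
    (hfg : ∀ n, f (p * n + (p - 1)) = g n) (hgf : ∀ n, g (p * n + (p - 1)) = f n) :
    HasMean f (t * (p * ∑ r ∈ range (p - 1), α r + ∑ r ∈ range (p - 1), β r) /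
      (((p : ℂ) - 1) * (p + 1))) := by
  obtain ⟨q, rfl⟩ : ∃ q, p = q + 1 := ⟨p - 1, by lia⟩
  simp only [Nat.add_sub_cancel] at *
  -- The combinations f ± g diagonalise the swap: the digit p - 1 multiplies them by s = ±1, whence
  -- the denominators p ∓ 1.
  have hmean (s : ℂ) (hs : s = 1 ∨ s = -1) : HasMean (fun n => f n + s * g n)
      (t * (∑ r ∈ range q, α r + s * ∑ r ∈ range q, β r) / (((q + 1 : ℕ) : ℂ) - s)) := by
    have hsn : ‖s‖ = 1 := by rcases hs with rfl | rfl <;> simp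
    have hs2 : s * s = 1 := by rcases hs with rfl | rfl <;> simp
    have := HasMean.of_digit_recurrence (p := q + 1) (by lia) (f := fun n => f n + s * g n)
      (B := B + B)
      (fun n => (norm_add_le _ _).trans
        (add_le_add (hfB n) (by rw [norm_mul, hsn, one_mul]; exact hgB n)))
      (c := fun r => if r = q then s else 0)
      (d := fun r => if r = q then 0 else (α r + s * β r) * t)
      (h := fun r n => if r = q then 0 else (α r + s * β r) * u n) ?_ ?_ ?_
    · convert this using 1
      rw [sum_range_succ, sum_range_succ, if_pos rfl, if_pos rfl]
      rw [sum_congr rfl fun r hr => if_neg (mem_range.1 hr).ne]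
      rw [sum_congr rfl fun r hr => if_neg (mem_range.1 hr).ne]
      simp only [sum_const_zero, zero_add, add_zero, ← sum_mul, sum_add_distrib, ← mul_sum]
      ring
    · intro n r hr
      rcases eq_or_ne r q with rfl | hrq
      · simp only [if_true, hfg, hgf]
        linear_combination (-g n) * hs2
      · simp only [if_neg hrq, hf n r (by lia), hg n r (by lia)]
        ring
    · intro r hr
      by_cases hrq : r = q
      · simpa [hrq] using hasMean_const 0
      · simpa only [if_neg hrq] using hu.const_mul _
    · rw [sum_ite_eq' (range (q + 1)) q (fun _ => s), if_pos (by simp), hsn]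
      exact_mod_cast hp
  have h := ((hmean 1 (Or.inl rfl)).add (hmean (-1) (Or.inr rfl))).const_mul (1 / 2)
  have hq : (q : ℂ) ≠ 0 := by
    have : q ≠ 0 := by lia
    exact_mod_cast this
  have hq2 : (q : ℂ) + 1 + 1 ≠ 0 := by exact_mod_cast (by lia : q + 1 + 1 ≠ 0)
  convert h using 1
  · ext n
    ring
  · push_cast
    rw [add_sub_cancel_right, sub_neg_eq_add]
    field_simp
    ring

theorem hasAsymptoticDensity_iff {S : Set ℕ} {d : ℝ} [DecidablePred (· ∈ S)] :
    HasAsymptoticDensity S d ↔ HasMean (fun n => if n ∈ S then 1 else 0) d := by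
  rw [HasAsymptoticDensity, HasMean, ← tendsto_ofReal_iff]
  refine tendsto_congr fun N => ?_
  have : S ∩ {n | n < N} = ((range N).filter (· ∈ S) : Finset ℕ) := by
    ext n
    simp [and_comm]
  rw [this, Set.ncard_coe_finset, sum_boole]
  push_cast
  rfl

end Mean

/-! ### Means of characters along central trinomial coefficients -/

section CharacterMeans

open Finset

/-- Strict convexity of the unit disc gives |f 0 + f m| < 2. This is the contraction needed for
character means along T. -/
theorem norm_sum_range_lt {p m : ℕ} (hm : m < p) {f : ℕ → ℂ} (hf : ∀ r, ‖f r‖ ≤ 1) (h0 : f 0 = 1)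
    (hm1 : f m ≠ 1) : ‖∑ r ∈ range p, f r‖ < p := by
  have hm0 : m ≠ 0 := by
    rintro rfl
    exact hm1 h0
  have hlt : ‖f 0 + f m‖ < 2 := by
    have h := norm_combo_lt_of_ne (hf 0) (hf m) (h0 ▸ hm1.symm) (a := 1 / 2) (b := 1 / 2)
      (by norm_num) (by norm_num) (by norm_num)
    rw [← smul_add, norm_smul] at h
    norm_num at h
    linarith
  have hmem : m ∈ (range p).erase 0 := by simp [hm0, hm]
  rw [← add_sum_erase _ _ (mem_range.2 (by lia : 0 < p)), ← add_sum_erase _ _ hmem, ← add_assoc]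
  have hrest : ‖∑ r ∈ ((range p).erase 0).erase m, f r‖ ≤ p - 2 := by
    refine (norm_sum_le _ _).trans ((sum_le_sum fun r _ => hf r).trans ?_)
    rw [sum_const, card_erase_of_mem hmem, card_erase_of_mem (mem_range.2 (by lia)), card_range,
      nsmul_eq_mul, mul_one, Nat.sub_sub, Nat.cast_sub (by lia)]
    norm_num
  have := norm_add_le (f 0 + f m) (∑ r ∈ ((range p).erase 0).erase m, f r)
  linarith

theorem sum_range_eq_add_add {M : Type*} [AddCommMonoid M] {p : ℕ} (hp : 2 ≤ p) (f : ℕ → M) :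
    ∑ r ∈ range p, f r = ∑ r ∈ range (p - 2), f r + f (p - 2) + f (p - 1) := by
  obtain ⟨q, rfl⟩ : ∃ q, p = q + 2 := ⟨p - 2, by lia⟩
  rw [sum_range_succ, sum_range_succ]
  rfl

variable {p : ℕ} [Fact p.Prime]

theorem one_char_apply (x : ZMod p) :
    (1 : DirichletCharacter ℂ p) x = if x = 0 then 0 else 1 := by
  split_ifs with h
  · rw [h, MulChar.map_zero]
  · exact MulChar.one_apply (isUnit_iff_ne_zero.2 h)

theorem norm_one_char_apply (x : ZMod p) :
    (‖(1 : DirichletCharacter ℂ p) x‖ : ℂ) = (1 : DirichletCharacter ℂ p) x := by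
  rw [one_char_apply]
  split_ifs <;> simp

theorem sum_one_char (m : ℕ) (g : ℕ → ZMod p) {S : Set ℕ} (hS : ∀ r, r ∈ S ↔ r < m ∧ g r = 0) :
    ∑ r ∈ range m, (1 : DirichletCharacter ℂ p) (g r) = m - S.ncard := by
  have e : S = ((range m).filter (fun r => g r = 0) : Finset ℕ) := by
    ext r
    simp [hS]
  have h (r : ℕ) : (1 : DirichletCharacter ℂ p) (g r) = 1 - if g r = 0 then 1 else 0 := by
    rw [one_char_apply]
    split_ifs <;> simp
  rw [e, Set.ncard_coe_finset, sum_congr rfl fun r _ => h r, sum_sub_distrib, sum_boole]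
  simp

variable (a b : ZMod p)

/-- By Lucas, χ(T_{pn+r}) = χ(T_r) χ(T_n). This serves both the principal character with T_m = 0 and
nontrivial characters. -/
theorem hasMean_char_walk {m : ℕ} (hm : m < p) (χ : DirichletCharacter ℂ p)
    (hχ : χ (walk a b m 0) ≠ 1) : HasMean (fun n => χ (walk a b n 0)) 0 := by
  have h := HasMean.of_digit_recurrence (Nat.Prime.pos (Fact.out : p.Prime))
    (f := fun n => χ (walk a b n 0)) (fun n => χ.norm_le_one _)
    (c := fun r => χ (walk a b r 0)) (h := fun _ _ => 0) (d := fun _ => 0)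
    (fun n r hr => by rw [walk_lucas a b n hr, map_mul, mul_comm, add_zero])
    (fun _ _ => hasMean_const 0)
    (norm_sum_range_lt hm (fun r => χ.norm_le_one _) (by simp [walk_zero]) hχ)
  simpa using h

theorem walk_one_lucas (n : ℕ) {r : ℕ} (hr : r < p) :
    walk a b (p * n + r) 1 =
      walk a b n 0 * walk a b r 1 + walk a b n 1 * walk a b r (1 - p) := by
  simpa using walk_mul_add a b n hr 0 (s := 1) (Nat.Prime.one_lt Fact.out)

theorem walk_one_lucas_of_lt (n : ℕ) {r : ℕ} (hr : r < p - 1) :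
    walk a b (p * n + r) 1 = walk a b n 0 * walk a b r 1 := by
  rw [walk_one_lucas a b n (by lia), walk_eq_zero_of_lt a b r (1 - p) (by grind), mul_zero,
    add_zero]

/-- The carry term has the extreme coefficient a^(p-1), which is 1 by Fermat; hence [x¹] Pⁿ is
passed on unchanged when T_n = 0. -/
theorem walk_one_lucas_last (ha : a ≠ 0) (n : ℕ) :
    walk a b (p * n + (p - 1)) 1 = walk a b n 0 * walk a b (p - 1) 1 + walk a b n 1 := by
  have hp := Nat.Prime.one_lt (Fact.out : p.Prime)
  rw [walk_one_lucas a b n (by lia), show (1 : ℤ) - p = -((p - 1 : ℕ) : ℤ) by lia, walk_neg,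
    walk_self, ZMod.pow_card_sub_one_eq_one ha, mul_one]

theorem walk_two_lucas_eq_zero {n : ℕ} (h0 : walk a b n 0 = 0) (h1 : walk a b n 1 = 0) {r : ℕ}
    (hr : r < p) : walk a b (p * n + r) 2 = 0 := by
  -- For p = 2 the height 2 is not a digit and must be written as p · 1 + 0.
  rcases (Nat.Prime.two_le (Fact.out : p.Prime)).eq_or_lt with h2 | h2
  · have h := walk_mul_add a b n hr 1 (s := 0) (by lia)
    rw [show (p : ℤ) * 1 + (0 : ℕ) = 2 by lia, h1,
      walk_eq_zero_of_lt a b r ((0 : ℕ) - p) (by grind)] at h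
    simpa using h
  · simpa [h0, h1] using walk_mul_add a b n hr 0 (s := 2) h2

/-- If a central trinomial coefficient vanishes modulo `p`, then so do almost all Motzkin numbers. -/
theorem hasMean_one_char_motzkin_zero {m : ℕ} (hm : m < p) (hm0 : walk a b m 0 = 0) :
    HasMean (fun n => (1 : DirichletCharacter ℂ p) (walk a b n 0 - walk a b n 2)) 0 := by
  have hp := Nat.Prime.one_lt (Fact.out : p.Prime)
  have hT : HasMean (fun n => (1 : DirichletCharacter ℂ p) (walk a b n 0)) 0 :=
    hasMean_char_walk a b hm 1 (by simp [hm0, one_char_apply])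
  rcases eq_or_ne a 0 with rfl | ha
  · simpa [walk_zero_weight] using hT
  set w : ℕ → ℂ := fun n => if walk a b n 0 = 0 ∧ walk a b n 1 = 0 then 0 else 1 with hw
  have hw1 (n : ℕ) : ‖w n‖ ≤ 1 := by
    simp only [hw]
    split_ifs <;> simp
  have hw_mean : HasMean w 0 := by
    -- Up to errors supported where T_n ≠ 0, a set of density zero, `w` is preserved by the digit p
    -- - 1 and killed by the others; the total factor is 1 < p.
    have h := HasMean.of_digit_recurrence (p := p) (by lia) hw1
      (c := fun r => if r = p - 1 then 1 else 0) (d := fun _ => 0)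
      (h := fun r n => w (p * n + r) - (if r = p - 1 then 1 else 0) * w n)
      (fun n r _ => by ring) ?_ ?_
    · simpa using h
    · intro r hr
      refine HasMean.zero_of_norm_le (g := fun n => (1 : DirichletCharacter ℂ p) (walk a b n 0))
        (by simpa only [norm_one_char_apply] using hT) fun n => ?_
      rcases eq_or_ne r (p - 1) with rfl | hr1
      · simp only [hw, one_char_apply, if_true, walk_lucas a b n hr, walk_one_lucas_last a b ha n]
        by_cases h0 : walk a b n 0 = 0
        · simp [h0]
        · simp only [h0, false_and, if_false]
          split_ifs <;> simp
      · simp only [hw, one_char_apply, if_neg hr1, walk_lucas a b n hr,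
          walk_one_lucas_of_lt a b n (show r < p - 1 by lia)]
        by_cases h0 : walk a b n 0 = 0
        · simp [h0]
        · simp only [h0, if_false]
          split_ifs <;> simp
    · rw [sum_ite_eq' (range p) (p - 1) (fun _ => (1 : ℂ)), if_pos (by simp; lia)]
      simpa using hp
  have h := HasMean.of_digits (p := p) (by lia)
    (f := fun n => (1 : DirichletCharacter ℂ p) (walk a b n 0 - walk a b n 2))
    (fun n => DirichletCharacter.norm_le_one _ _) (d := fun _ => 0) ?_
  · simpa using h
  · intro r hr
    refine HasMean.zero_of_norm_le (g := w) ?_ fun n => ?_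
    · convert hw_mean using 2 with n
      simp only [hw]
      split_ifs <;> simp
    · simp only [hw]
      split_ifs with h
      · rw [walk_lucas a b n hr, h.1, walk_two_lucas_eq_zero a b h.1 h.2 hr]
        simp [one_char_apply]
      · simpa using DirichletCharacter.norm_le_one _ _

end CharacterMeans

/-! ### The case of nonvanishing central trinomial coefficients -/

section Nonvanishing

open Finset

variable {p : ℕ} [Fact p.Prime] {a b : ZMod p}

theorem walk_ne_zero (hT : ∀ n < p, walk a b n 0 ≠ 0) (n : ℕ) : walk a b n 0 ≠ 0 := by
  induction n using Nat.strong_induction_on with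
  | _ n ih =>
  have hp := Nat.Prime.one_lt (Fact.out : p.Prime)
  by_cases hn : n < p
  · exact hT n hn
  · rw [← Nat.div_add_mod n p, walk_lucas a b _ (Nat.mod_lt n (by lia))]
    exact mul_ne_zero (ih _ (Nat.div_lt_self (by lia) hp)) (hT _ (Nat.mod_lt n (by lia)))

/-- The symmetry at m = p - 1 reads (b² - 4a²)^(p-1) = T_{p-1}². With Fermat it also yields the next
lemma, ε² = 1. -/
theorem walk_discrim_ne_zero (hT : ∀ n < p, walk a b n 0 ≠ 0) : b ^ 2 - 4 * a ^ 2 ≠ 0 := by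
  have hp := Nat.Prime.one_lt (Fact.out : p.Prime)
  intro h
  have hs := walk_symm a b (show p - 1 < p by lia)
  rw [h, zero_pow (by lia), zero_mul] at hs
  exact mul_ne_zero (hT _ (by lia)) (hT _ (by lia)) hs.symm

theorem walk_pred_mul_self (hT : ∀ n < p, walk a b n 0 ≠ 0) :
    walk a b (p - 1) 0 * walk a b (p - 1) 0 = 1 := by
  have hp := Nat.Prime.one_lt (Fact.out : p.Prime)
  rw [← walk_symm a b (show p - 1 < p by lia), Nat.sub_self,
    ZMod.pow_card_sub_one_eq_one (walk_discrim_ne_zero hT)]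
  simp [walk_zero]

/-- The indices r, r + 1, r + 2 are all below p, so no carry occurs. -/
theorem motzkin_lucas (ha : 2 * a ^ 2 ≠ 0) (n : ℕ) {r : ℕ} (hr : r < p - 2) :
    walk a b (p * n + r) 0 - walk a b (p * n + r) 2 =
      (walk a b r 0 - walk a b r 2) * walk a b n 0 := by
  apply mul_left_cancel₀ ha
  rw [two_mul_sq_mul_walk_sub, ← mul_assoc, two_mul_sq_mul_walk_sub, add_assoc, add_assoc,
    walk_lucas a b n (show r < p by lia), walk_lucas a b n (show r + 1 < p by lia),
    walk_lucas a b n (show r + 2 < p by lia)]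
  ring

/-- Only the index r + 2 = p carries; the symmetry at m = 1 evaluates T_{p-2}. -/
theorem motzkin_lucas_sub_two (n : ℕ) :
    2 * a ^ 2 * (walk a b (p * n + (p - 2)) 0 - walk a b (p * n + (p - 2)) 2) =
      b * walk a b (p - 1) 0 * walk a b n 0 - walk a b (n + 1) 0 := by
  have hp := Nat.Prime.two_le (Fact.out : p.Prime)
  have hs := walk_symm a b (show 1 < p by lia)
  rw [show p - 1 - 1 = p - 2 by lia, walk_succ_zero] at hs
  simp only [walk_zero] at hs
  rw [two_mul_sq_mul_walk_sub, show p * n + (p - 2) + 1 = p * n + (p - 1) by lia,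
    show p * n + (p - 2) + 2 = p * n + p by lia, walk_lucas_succ,
    walk_lucas a b n (show p - 1 < p by lia), walk_lucas a b n (show p - 2 < p by lia)]
  simp at hs
  linear_combination (-walk a b n 0) * hs

theorem motzkin_lucas_sub_one (n : ℕ) :
    2 * a ^ 2 * (walk a b (p * n + (p - 1)) 0 - walk a b (p * n + (p - 1)) 2) =
      b * walk a b (n + 1) 0 - (b ^ 2 - 4 * a ^ 2) * walk a b (p - 1) 0 * walk a b n 0 := by
  have hp := Nat.Prime.two_le (Fact.out : p.Prime)
  rw [two_mul_sq_mul_walk_sub, show p * n + (p - 1) + 1 = p * n + p by lia,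
    show p * n + (p - 1) + 2 = p * n + p + 1 by lia, walk_lucas_succ, walk_lucas_succ_succ,
    walk_lucas a b n (show p - 1 < p by lia)]
  ring

variable (a b) in
/-- The factor by which the mean of `χ` along a linear form in two consecutive central trinomial
coefficients differs from the mean along the central trinomial coefficients. -/
noncomputable def linearFormFactor (χ : DirichletCharacter ℂ p) (x y : ZMod p) : ℂ :=
  (p * ∑ r ∈ range (p - 1), χ (x * walk a b (p - 1) 0 * walk a b r 0 + y * walk a b (r + 1) 0) +
    ∑ r ∈ range (p - 1), χ (x * walk a b r 0 + y * walk a b (r + 1) 0)) /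
      (((p : ℂ) - 1) * (p + 1))

/-- The partner form drops ε from the first coefficient. The digit p - 1 inserts a factor ε, and ε²
= 1 makes this an exchange. -/
theorem hasMean_char_linear_form (hT : ∀ n < p, walk a b n 0 ≠ 0) (χ : DirichletCharacter ℂ p)
    {t : ℂ} (ht : HasMean (fun n => χ (walk a b n 0)) t) (x y : ZMod p) :
    HasMean (fun n => χ (x * walk a b (p - 1) 0 * walk a b n 0 + y * walk a b (n + 1) 0))
      (t * linearFormFactor a b χ x y) := by
  have hp := Nat.Prime.one_lt (Fact.out : p.Prime)
  have hε := walk_pred_mul_self hT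
  rw [linearFormFactor, ← mul_div_assoc]
  refine HasMean.of_swap hp (g := fun n => χ (x * walk a b n 0 + y * walk a b (n + 1) 0))
    (fun n => χ.norm_le_one _) (fun n => χ.norm_le_one _) ht ?_ ?_ ?_ ?_
  · intro n r hr
    rw [add_assoc, walk_lucas a b n (show r < p by lia),
      walk_lucas a b n (show r + 1 < p by lia), ← map_mul]
    congr 1
    ring
  · intro n r hr
    rw [add_assoc, walk_lucas a b n (show r < p by lia),
      walk_lucas a b n (show r + 1 < p by lia), ← map_mul]
    congr 1
    ring
  · intro n
    rw [add_assoc, Nat.sub_add_cancel hp.le, walk_lucas_succ,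
      walk_lucas a b n (show p - 1 < p by lia)]
    congr 1
    linear_combination x * walk a b n 0 * hε
  · intro n
    rw [add_assoc, Nat.sub_add_cancel hp.le, walk_lucas_succ,
      walk_lucas a b n (show p - 1 < p by lia)]
    congr 1
    ring

variable (a b) in
/-- The factor by which the mean of `χ` along the Motzkin numbers differs from the mean along the
central trinomial coefficients. -/
noncomputable def motzkinFactor (χ : DirichletCharacter ℂ p) : ℂ :=
  (∑ r ∈ range (p - 2), χ (walk a b r 0 - walk a b r 2) +
    χ (2 * a ^ 2)⁻¹ * linearFormFactor a b χ b (-1) +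
    χ (2 * a ^ 2)⁻¹ * linearFormFactor a b χ (-(b ^ 2 - 4 * a ^ 2)) b) / p

theorem hasMean_char_motzkin (hT : ∀ n < p, walk a b n 0 ≠ 0) (ha : 2 * a ^ 2 ≠ 0)
    (χ : DirichletCharacter ℂ p) {t : ℂ} (ht : HasMean (fun n => χ (walk a b n 0)) t) :
    HasMean (fun n => χ (walk a b n 0 - walk a b n 2)) (motzkinFactor a b χ * t) := by
  have hp := Nat.Prime.two_le (Fact.out : p.Prime)
  have h1 := (hasMean_char_linear_form hT χ ht b (-1)).const_mul (χ (2 * a ^ 2)⁻¹)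
  have h2 := (hasMean_char_linear_form hT χ ht (-(b ^ 2 - 4 * a ^ 2)) b).const_mul
    (χ (2 * a ^ 2)⁻¹)
  have h := HasMean.of_digits (p := p) (by lia)
    (f := fun n => χ (walk a b n 0 - walk a b n 2)) (fun n => χ.norm_le_one _)
    (d := fun r => if r < p - 2 then χ (walk a b r 0 - walk a b r 2) * t else
      if r = p - 2 then χ (2 * a ^ 2)⁻¹ * (t * linearFormFactor a b χ b (-1)) else
        χ (2 * a ^ 2)⁻¹ * (t * linearFormFactor a b χ (-(b ^ 2 - 4 * a ^ 2)) b)) ?_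
  · convert h using 1
    rw [sum_range_eq_add_add hp, sum_congr rfl fun r hr => if_pos (mem_range.1 hr),
      if_neg (lt_irrefl _), if_pos rfl, if_neg (by lia), if_neg (by lia), ← sum_mul,
      motzkinFactor]
    ring
  · intro r hr
    rcases lt_or_ge r (p - 2) with h | h
    · simpa only [if_pos h, motzkin_lucas ha _ h, map_mul] using ht.const_mul _
    rcases h.eq_or_lt with rfl | h
    · rw [if_neg (lt_irrefl _), if_pos rfl]
      convert h1 using 2 with n
      rw [← map_mul]
      congr 1
      rw [eq_inv_mul_iff_mul_eq₀ ha, motzkin_lucas_sub_two]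
      ring
    · obtain rfl : r = p - 1 := by lia
      rw [if_neg (by lia), if_neg (by lia)]
      convert h2 using 2 with n
      rw [← map_mul]
      congr 1
      rw [eq_inv_mul_iff_mul_eq₀ ha, motzkin_lucas_sub_one]
      ring

/-- Under r ↦ p - 2 - r, `walk_symm` carries one form to a unit multiple of the other, which the
principal character does not see. So the digits p - 2 and p - 1 contribute equally, whence the
factors 2 in the density formula. -/
theorem sum_one_char_symm (hT : ∀ n < p, walk a b n 0 ≠ 0) (ε : ZMod p) (hε : ε * ε = 1) :
    ∑ r ∈ range (p - 1), (1 : DirichletCharacter ℂ p)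
        (-(b ^ 2 - 4 * a ^ 2) * ε * walk a b r 0 + b * walk a b (r + 1) 0) =
      ∑ r ∈ range (p - 1), (1 : DirichletCharacter ℂ p)
        (b * ε * walk a b r 0 + -1 * walk a b (r + 1) 0) := by
  have hp := Nat.Prime.two_le (Fact.out : p.Prime)
  rw [← sum_range_reflect]
  refine sum_congr rfl fun r hr => ?_
  rw [mem_range] at hr
  have hε0 : ε ≠ 0 := left_ne_zero_of_mul_eq_one hε
  have hu : (b ^ 2 - 4 * a ^ 2) ^ r * ε * walk a b (p - 1) 0 ≠ 0 :=
    mul_ne_zero (mul_ne_zero (pow_ne_zero _ (walk_discrim_ne_zero hT)) hε0) (hT _ (by lia))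
  have h1 := walk_symm a b (show r < p by lia)
  have h2 := walk_symm a b (show r + 1 < p by lia)
  rw [show p - 1 - 1 - r + 1 = p - 1 - r by lia, show p - 1 - 1 - r = p - 1 - (r + 1) by lia]
  have key : b * ε * walk a b r 0 + -1 * walk a b (r + 1) 0 =
      (b ^ 2 - 4 * a ^ 2) ^ r * ε * walk a b (p - 1) 0 *
        (-(b ^ 2 - 4 * a ^ 2) * ε * walk a b (p - 1 - (r + 1)) 0 + b * walk a b (p - 1 - r) 0) := by
    have hε' := walk_pred_mul_self hT
    linear_combination (-ε * b * walk a b (p - 1) 0) * h1 + (ε * ε * walk a b (p - 1) 0) * h2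
      - (ε * b * walk a b r 0) * hε' + walk a b (r + 1) 0 * hε'
      + walk a b (r + 1) 0 * walk a b (p - 1) 0 * walk a b (p - 1) 0 * hε
  rw [key, map_mul, MulChar.one_apply (isUnit_iff_ne_zero.2 hu), one_mul]

theorem motzkinFactor_one (hT : ∀ n < p, walk a b n 0 ≠ 0) (ha : 2 * a ^ 2 ≠ 0) :
    motzkinFactor a b (1 : DirichletCharacter ℂ p) = 1 -
      ((({n : ℕ | n < p - 2 ∧ walk a b n 0 - walk a b n 2 = 0}.ncard : ℝ) / p
      + 2 * ({m : ℕ | m < p - 1 ∧ b * walk a b m 0 =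
          walk a b (p - 1) 0 * walk a b (m + 1) 0}.ncard : ℝ) / (((p : ℝ) - 1) * (p + 1))
      + 2 * ({m : ℕ | m < p - 1 ∧ b * walk a b m 0 = walk a b (m + 1) 0}.ncard : ℝ)
        / (((p : ℝ) - 1) * p * (p + 1)) : ℝ) : ℂ) := by
  have hp := Nat.Prime.two_le (Fact.out : p.Prime)
  have hε := walk_pred_mul_self hT
  have s1 := sum_one_char_symm hT _ hε
  have s2 := sum_one_char_symm hT 1 (one_mul 1)
  simp only [mul_one] at s2
  rw [motzkinFactor, linearFormFactor, linearFormFactor, s1, s2,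
    sum_one_char _ (fun r => walk a b r 0 - walk a b r 2)
      (S := {n : ℕ | n < p - 2 ∧ walk a b n 0 - walk a b n 2 = 0}) (fun r => Iff.rfl),
    sum_one_char _ (fun r => b * walk a b (p - 1) 0 * walk a b r 0 + -1 * walk a b (r + 1) 0)
      (S := {m : ℕ | m < p - 1 ∧ b * walk a b m 0 = walk a b (p - 1) 0 * walk a b (m + 1) 0}),
    sum_one_char _ (fun r => b * walk a b r 0 + -1 * walk a b (r + 1) 0)
      (S := {m : ℕ | m < p - 1 ∧ b * walk a b m 0 = walk a b (m + 1) 0}),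
    one_char_apply, if_neg (inv_ne_zero ha), Nat.cast_sub hp, Nat.cast_sub (by lia : 1 ≤ p)]
  · have h0 : (p : ℂ) ≠ 0 := by exact_mod_cast (by lia : p ≠ 0)
    have h1 : (p : ℂ) - 1 ≠ 0 := by
      rw [sub_ne_zero]
      exact_mod_cast (by lia : p ≠ 1)
    have h2 : (p : ℂ) + 1 ≠ 0 := by exact_mod_cast (by lia : p + 1 ≠ 0)
    push_cast
    field_simp
    ring
  · intro r
    simp only [Set.mem_ofPred_eq, neg_mul, one_mul, ← sub_eq_add_neg, sub_eq_zero]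
  · intro r
    simp only [Set.mem_ofPred_eq, and_congr_right_iff]
    intro _
    -- Multiplication by ε = T_{p-1} moves it to the other side, since ε² = 1.
    constructor
    · intro h
      linear_combination walk a b (p - 1) 0 * h + walk a b (r + 1) 0 * hε
    · intro h
      linear_combination walk a b (p - 1) 0 * h - b * walk a b r 0 * hε

/-- A character equal to 1 at all T_r with r < p would be trivial on the group they generate. -/
theorem hasMean_char_walk_of_closure
    (hgen : Subgroup.closure {u : (ZMod p)ˣ | ∃ n < p, (u : ZMod p) = walk a b n 0} = ⊤)
    {χ : DirichletCharacter ℂ p} (hχ : χ ≠ 1) : HasMean (fun n => χ (walk a b n 0)) 0 := by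
  obtain ⟨m, hm, h⟩ : ∃ m < p, χ (walk a b m 0) ≠ 1 := by
    by_contra! hall
    refine hχ (MulChar.ext fun u => ?_)
    rw [MulChar.one_apply_coe]
    have hu : u ∈ Subgroup.closure {u : (ZMod p)ˣ | ∃ n < p, (u : ZMod p) = walk a b n 0} :=
      hgen ▸ Subgroup.mem_top u
    induction hu using Subgroup.closure_induction with
    | mem x hx =>
      obtain ⟨n, hn, hx⟩ := hx
      rw [hx, hall n hn]
    | one => simp
    | mul x y _ _ hx hy => rw [Units.val_mul, map_mul, hx, hy, one_mul]
    | inv x _ hx =>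
      have h := congrArg χ x.inv_mul
      rw [map_mul, hx, mul_one, map_one] at h
      exact h
  exact hasMean_char_walk a b hm χ h

end Nonvanishing

/-! ### Densities of residues -/

section Density

variable {p : ℕ} [Fact p.Prime]

theorem hasAsymptoticDensity_zero_iff (x : ℕ → ZMod p) (d : ℝ) :
    HasAsymptoticDensity {n | x n = 0} d ↔
      HasMean (fun n => (1 : DirichletCharacter ℂ p) (x n)) (1 - d) := by
  rw [hasAsymptoticDensity_iff]
  constructor
  · intro h
    convert (hasMean_const 1).sub h using 2 with n
    rw [one_char_apply]
    simp only [Set.mem_ofPred_eq]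
    split_ifs <;> simp
  · intro h
    convert (hasMean_const 1).sub h using 2 with n
    · rw [one_char_apply]
      simp only [Set.mem_ofPred_eq]
      split_ifs <;> simp
    · ring

/-- A sequence whose nontrivial character means vanish is equidistributed among the nonzero
residues. -/
theorem hasAsymptoticDensity_of_char (x : ℕ → ZMod p) {d : ℝ}
    (h0 : HasAsymptoticDensity {n | x n = 0} d)
    (hχ : ∀ χ : DirichletCharacter ℂ p, χ ≠ 1 → HasMean (fun n => χ (x n)) 0)
    {k : ZMod p} (hk : k ≠ 0) :
    HasAsymptoticDensity {n | x n = k} ((1 - d) / ((p : ℝ) - 1)) := by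
  classical
  have hp := Nat.Prime.two_le (Fact.out : p.Prime)
  rw [hasAsymptoticDensity_zero_iff] at h0
  rw [hasAsymptoticDensity_iff]
  -- Orthogonality: averaging χ(k⁻¹) χ(x n) over the p - 1 characters gives the indicator of x n =
  -- k.
  have h := (HasMean.sum Finset.univ (f := fun (χ : DirichletCharacter ℂ p) n => χ k⁻¹ * χ (x n))
    (d := fun χ => if χ = 1 then 1 - (d : ℂ) else 0) ?_).const_mul (1 / ((p : ℂ) - 1))
  · have hne : (p : ℂ) - 1 ≠ 0 := by
      rw [sub_ne_zero]
      exact_mod_cast (by lia : p ≠ 1)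
    convert h using 2 with n
    · rw [DirichletCharacter.sum_char_inv_mul_char_eq ℂ (isUnit_iff_ne_zero.2 hk),
        Nat.totient_prime Fact.out, Nat.cast_sub (by lia)]
      simp only [Set.mem_ofPred_eq, eq_comm (a := k)]
      split_ifs
      · push_cast
        field_simp
      · simp
    · rw [Finset.sum_ite_eq' Finset.univ (1 : DirichletCharacter ℂ p), if_pos (Finset.mem_univ _)]
      push_cast
      ring
  · intro χ _
    by_cases h1 : χ = 1
    · rw [if_pos h1, h1]
      convert h0 using 2 with n
      rw [one_char_apply, if_neg (inv_ne_zero hk), one_mul]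
    · rw [if_neg h1]
      simpa using (hχ χ h1).const_mul (χ k⁻¹)

end Density

theorem intCast_centralTrinomial (p : ℕ) (a b : ℤ) (n : ℕ) :
    (centralTrinomial a b n : ZMod p) = walk (a : ZMod p) (b : ZMod p) n 0 := by
  rw [centralTrinomial_eq_walk]
  exact map_walk a b (Int.castRingHom (ZMod p)) n 0

theorem intCast_motzkin (p : ℕ) (a b : ℤ) (n : ℕ) :
    (motzkin a b n : ZMod p) =
      walk (a : ZMod p) (b : ZMod p) n 0 - walk (a : ZMod p) (b : ZMod p) n 2 := by
  rw [motzkin_eq_walk_sub, Int.cast_sub]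
  congr 1
  · exact map_walk a b (Int.castRingHom (ZMod p)) n 0
  · exact map_walk a b (Int.castRingHom (ZMod p)) n 2

theorem mainTheorem1 (p : ℕ) (hp : p.Prime) (a b : ℤ) :
    ((∃ n < p, (centralTrinomial a b n : ZMod p) = 0) → MotzkinDensity p a b 0 1) ∧
    ((∀ n < p, (centralTrinomial a b n : ZMod p) ≠ 0) → 2 < p →
      ∃ D₀ : ℝ, MotzkinDensity p a b 0 D₀ ∧
        (¬ (p : ℤ) ∣ a → D₀ = zeroDensityFormula p a b) ∧
        (Subgroup.closure {u : (ZMod p)ˣ | ∃ n < p, (u : ZMod p) = centralTrinomial a b n} = ⊤ →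
          ∀ k : ZMod p, k ≠ 0 → MotzkinDensity p a b k ((1 - D₀) / ((p : ℝ) - 1)))) := by
  have : Fact p.Prime := ⟨hp⟩
  simp only [MotzkinDensity, zeroDensityFormula, intCast_motzkin, intCast_centralTrinomial,
    ← ZMod.intCast_zmod_eq_zero_iff_dvd]
  generalize (a : ZMod p) = a
  generalize (b : ZMod p) = b
  refine ⟨?_, fun hT hp2 => ?_⟩
  · rintro ⟨m, hm, hm0⟩
    rw [hasAsymptoticDensity_zero_iff]
    simpa using hasMean_one_char_motzkin_zero a b hm hm0
  have hT1 : HasMean (fun n => (1 : DirichletCharacter ℂ p) (walk a b n 0)) 1 := by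
    simpa only [one_char_apply, if_neg (walk_ne_zero hT _)] using hasMean_const 1
  -- If p ∣ a, division by 2a² is impossible, but then M_n = T_n never vanishes and D₀ = 0.
  rcases eq_or_ne a 0 with rfl | ha
  · have hM (n : ℕ) : walk 0 b n 0 - walk 0 b n 2 = walk 0 b n 0 := by
      rw [walk_zero_weight b n 2 two_ne_zero, sub_zero]
    have hD : HasAsymptoticDensity {n | walk 0 b n 0 - walk 0 b n 2 = 0} 0 := by
      rw [hasAsymptoticDensity_zero_iff]
      simpa [hM] using hT1
    refine ⟨0, hD, fun h => absurd rfl h, fun hgen k hk => ?_⟩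
    refine hasAsymptoticDensity_of_char _ hD (fun χ hχ => ?_) hk
    simpa only [hM] using hasMean_char_walk_of_closure hgen hχ
  · have ha' : 2 * a ^ 2 ≠ 0 := by
      refine mul_ne_zero (fun h => ?_) (pow_ne_zero _ ha)
      have : ((2 : ℕ) : ZMod p) = 0 := by exact_mod_cast h
      rw [ZMod.natCast_eq_zero_iff] at this
      exact absurd (Nat.le_of_dvd two_pos this) (by lia)
    have hD := hasMean_char_motzkin hT ha' 1 hT1
    rw [mul_one, motzkinFactor_one hT ha', ← hasAsymptoticDensity_zero_iff] at hD
    refine ⟨_, hD, fun _ => rfl, fun hgen k hk => ?_⟩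
    refine hasAsymptoticDensity_of_char _ hD (fun χ hχ => ?_) hk
    simpa using hasMean_char_motzkin hT ha' χ (hasMean_char_walk_of_closure hgen hχ)
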